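/- **Model.** A sporadic task $\tau_i$ has worst-case execution time $C_i>0$, relative deadline $D_i>0$ and minimum inter-arrival time $T_i>0$, with no relation imposed between $D_i$ and $T_i$ (arbitrary deadlines). It releases an infinite sequence of jobs whose arrival times are separated by at least $T_i$; each job needs at most $C_i$ units of execution (at unit speed) and has to finish at most $D_i$ time units after its arrival. Jobs are executed on $M$ identical processors, with preemption and migration allowed; at every instant at most one job of each task executes, on at most one processor. On processors of speed $s$, a job that executes for $x$ time units receives $sx$ units of execution. A finite task set is feasible on $M$ processors of speed $s$ if every job sequence it can release has a schedule in which all deadlines are met. Global deadline-monotonic (DM) scheduling gives the tasks unique fixed priorities such that $\tau_i$ has higher priority than $\tau_j$ only if $D_i\le D_j$ (ties broken arbitrarily), serves the jobs of each task in order of arrival, and at every instant executes the $M$ highest-priority ready jobs (all of them if there are at most $M$). **Theorem.** Let $M\ge 2$. Global DM has a speedup bound of $3-\frac1M$ with respect to the optimal schedule: if a finite sporadic task set with arbitrary deadlines is feasible on $M$ identical processors of speed $1$, then, for every job sequence the task set can release, global DM on $M$ identical processors of speed $3-\frac1M$ (with any tie-breaking) produces a schedule that meets all deadlines. -/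

import Mathlib

open MeasureTheory

namespace GlobalScheduling

/-- A sporadic task: worst-case execution time `C` (on a unit-speed processor), relative deadline
`D` and minimum inter-arrival time `T`.  No relation between `D` and `T` is imposed
(arbitrary deadlines). -/
structure SporadicTask where
  C : ℝ
  D : ℝ
  T : ℝ
  C_pos : 0 < C
  D_pos : 0 < D
  T_pos : 0 < T

/-- A finite set of `N` sporadic tasks. -/
abbrev TaskSet (N : ℕ) := Fin N → SporadicTask

/-- One run-time behaviour of `N` tasks: job `j` of task `i` arrives at time `release i j` and
needs `exec i j` units of execution on a unit-speed processor. -/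
structure JobSeq (N : ℕ) where
  release : Fin N → ℕ → ℝ
  exec : Fin N → ℕ → ℝ

/-- The job sequence can be generated by the task set: consecutive jobs of a task are separated by
at least its minimum inter-arrival time and no job exceeds its worst-case execution time. -/
structure JobSeq.IsLegal {N : ℕ} (J : JobSeq N) (τ : TaskSet N) : Prop where
  separation : ∀ i j, J.release i j + (τ i).T ≤ J.release i (j + 1)
  exec_nonneg : ∀ i j, 0 ≤ J.exec i j
  exec_le : ∀ i j, J.exec i j ≤ (τ i).C

/-- A schedule on `M` processors: `σ p t` is the job (task index, job index) that processor `p`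
executes at time `t`, or `none` if the processor idles. -/
abbrev Schedule (M N : ℕ) := Fin M → ℝ → Option (Fin N × ℕ)

/-- Job `j` of task `i` executes on some processor at time `t`. -/
def Schedule.Runs {M N : ℕ} (σ : Schedule M N) (i : Fin N) (j : ℕ) (t : ℝ) : Prop :=
  ∃ p, σ p t = some (i, j)

/-- Amount of execution that job `j` of task `i` has received before time `t` when every processor
runs at speed `s`. -/
noncomputable def Schedule.service {M N : ℕ} (σ : Schedule M N) (s : ℝ) (i : Fin N) (j : ℕ)
    (t : ℝ) : ℝ :=
  s * volume.real {u : ℝ | u < t ∧ σ.Runs i j u}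

/-- Job `j` of task `i` is finished at time `t`. -/
def Schedule.Finished {M N : ℕ} (σ : Schedule M N) (s : ℝ) (J : JobSeq N) (i : Fin N) (j : ℕ)
    (t : ℝ) : Prop :=
  J.exec i j ≤ σ.service s i j t

/-- Legal preemptive schedules with migration on processors of speed `s`: jobs execute only between
their arrival and their completion, and at every instant at most one job of each task executes, on
at most one processor. -/
structure Schedule.IsValid {M N : ℕ} (σ : Schedule M N) (s : ℝ) (J : JobSeq N) : Prop where
  measurable : ∀ p i j, MeasurableSet {t : ℝ | σ p t = some (i, j)}
  sequential : ∀ p q t i j j', σ p t = some (i, j) → σ q t = some (i, j') → p = q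
  arrived : ∀ i j t, σ.Runs i j t → J.release i j ≤ t
  unfinished : ∀ i j t, σ.Runs i j t → ¬ σ.Finished s J i j t

/-- Every job is finished at its absolute deadline. -/
def Schedule.MeetsDeadlines {M N : ℕ} (σ : Schedule M N) (s : ℝ) (τ : TaskSet N)
    (J : JobSeq N) : Prop :=
  ∀ i j, σ.Finished s J i j (J.release i j + (τ i).D)

/-- The task set can be feasibly scheduled on `M` processors of speed `s` by an optimal (even
clairvoyant) scheduler: every job sequence that it can generate has a legal schedule that meets
all deadlines. -/
def Feasible (M : ℕ) (s : ℝ) {N : ℕ} (τ : TaskSet N) : Prop :=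
  ∀ J : JobSeq N, J.IsLegal τ → ∃ σ : Schedule M N, σ.IsValid s J ∧ σ.MeetsDeadlines s τ J

/-- A scheduling algorithm for `M` processors, given by the relation that, for a task set, a
processor speed and a job sequence, holds for the schedules that the algorithm may produce. -/
abbrev SchedulingAlgorithm (M : ℕ) :=
  ∀ N : ℕ, TaskSet N → ℝ → JobSeq N → Schedule M N → Prop

/-- On `M` processors of speed `s`, the algorithm always produces a legal schedule for the jobs of
the task set, and whatever it produces is legal and meets all deadlines. -/
def SchedulingAlgorithm.Schedules {M : ℕ} (A : SchedulingAlgorithm M) (s : ℝ) {N : ℕ}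
    (τ : TaskSet N) : Prop :=
  ∀ J : JobSeq N, J.IsLegal τ →
    (∃ σ : Schedule M N, A N τ s J σ) ∧
    ∀ σ : Schedule M N, A N τ s J σ → σ.IsValid s J ∧ σ.MeetsDeadlines s τ J

/-- `s` is a speedup bound of the algorithm with respect to the optimal schedule: whatever is
feasible on `M` unit-speed processors is scheduled by the algorithm on `M` processors of
speed `s`. -/
def SchedulingAlgorithm.HasSpeedupBound {M : ℕ} (A : SchedulingAlgorithm M) (s : ℝ) : Prop :=
  ∀ (N : ℕ) (τ : TaskSet N), Feasible M 1 τ → A.Schedules s τ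

/-- Job `j` of task `i` is ready at time `t`: it has arrived, it is not finished, and all earlier
jobs of the same task are finished (the jobs of one task are served in order of arrival). -/
def Schedule.Ready {M N : ℕ} (σ : Schedule M N) (s : ℝ) (J : JobSeq N) (i : Fin N) (j : ℕ)
    (t : ℝ) : Prop :=
  J.release i j ≤ t ∧ ¬ σ.Finished s J i j t ∧ ∀ j' < j, σ.Finished s J i j' t

/-- A rule that gives every task of every task set a static priority level; a smaller number is a
higher priority. -/
abbrev PriorityRule := ∀ N : ℕ, TaskSet N → Fin N → ℕ

/-- Deadline-monotonic priorities: priority levels are unique and a task of higher priority never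
has a larger relative deadline.  Ties between equal deadlines are broken arbitrarily. -/
structure PriorityRule.IsDeadlineMonotonic (prio : PriorityRule) : Prop where
  unique : ∀ (N : ℕ) (τ : TaskSet N), Function.Injective (prio N τ)
  monotone : ∀ (N : ℕ) (τ : TaskSet N) (i k : Fin N),
    prio N τ i < prio N τ k → (τ i).D ≤ (τ k).D

/-- Global fixed-priority preemptive scheduling on `M` processors: at every instant the `M`
highest-priority ready jobs (all of them, if there are at most `M`) execute.  That is, only ready
jobs execute, and a ready job waits only while every processor executes a job of higher
priority. -/
def globalFixedPriority (M : ℕ) (prio : PriorityRule) : SchedulingAlgorithm M :=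
  fun N τ s J σ =>
    σ.IsValid s J ∧
    (∀ i j t, σ.Runs i j t → σ.Ready s J i j t) ∧
    (∀ i j t, σ.Ready s J i j t → ¬ σ.Runs i j t →
      ∀ p, ∃ i' j', σ p t = some (i', j') ∧ prio N τ i' < prio N τ i)

end GlobalScheduling

/-!
Feasibility enters only through the demand of synchronous periodic jobs: `C ≤ T` and
`(n + 1) C ≤ n T + D` for each task, `∑ C ≤ M d` over the tasks with `D ≤ d`, and total utilization
at most `M`.

Suppose that under deadline-monotonic priorities and speed `s ≥ 3 - 1/M` a job of `τ_k` misses its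
deadline `d`, and let `H` be the set of tasks of priority at least that of `τ_k`. Whenever a task of
`H` is pending and does not run, `M` tasks of `H` run. As `τ_k` is pending on some `[u, d)` in which
it receives less than `d - u` units of execution, `H` receives at least `2M (d - u)` units there.
Let `t` be the first time such that `H` receives at least `2M (d - t)` units in `[t, d)`. If a task
of `H` is pending on all of `[v, t)`, then `H` receives less than `2M (t - v)` units in `[v, t)`, so
this task receives at least `t - v` of them, that is, at least its utilization times `t - v`. Hence
every task of `H` receives less than `C + (C / T) (d - t)` units in `[t, d)`. Summing over `H` gives
less than `M D_k + M (d - t) ≤ 2M (d - t)`, a contradiction.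
-/

namespace GlobalScheduling

section Measure

variable {A : Set ℝ}

/-- The measure of the part of `A` that precedes `t`. It is meaningful only if this part has finite
measure, as it does when `A` is bounded below. -/
noncomputable def timeBefore (A : Set ℝ) (t : ℝ) : ℝ := volume.real (Set.Iio t ∩ A)

lemma timeBefore_nonneg (A : Set ℝ) (t : ℝ) : 0 ≤ timeBefore A t := measureReal_nonneg

lemma volume_inter_Ico_ne_top (A : Set ℝ) (a b : ℝ) : volume (A ∩ Set.Ico a b) ≠ ⊤ :=
  measure_ne_top_of_subset Set.inter_subset_right measure_Ico_lt_top.ne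

lemma volume_inter_Ico_le (A : Set ℝ) {a b : ℝ} (hab : a ≤ b) :
    volume.real (A ∩ Set.Ico a b) ≤ b - a :=
  (measureReal_mono Set.inter_subset_right measure_Ico_lt_top.ne).trans_eq
    (Real.volume_real_Ico_of_le hab)

lemma volume_inter_Ico_add (A : Set ℝ) {a b c : ℝ} (hab : a ≤ b) (hbc : b ≤ c) :
    volume.real (A ∩ Set.Ico a c) =
      volume.real (A ∩ Set.Ico a b) + volume.real (A ∩ Set.Ico b c) := by
  rw [← measureReal_inter_add_sdiff₀ measurableSet_Iio.nullMeasurableSet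
    (volume_inter_Ico_ne_top A a c) (t := Set.Iio b)]
  congr 2 <;> grind

lemma volume_Iio_inter_ne_top (hA : BddBelow A) (t : ℝ) : volume (Set.Iio t ∩ A) ≠ ⊤ := by
  obtain ⟨r, hr⟩ := hA
  exact measure_ne_top_of_subset
    (show Set.Iio t ∩ A ⊆ Set.Ico r t from fun u hu => ⟨hr hu.2, hu.1⟩) measure_Ico_lt_top.ne

lemma timeBefore_le_of_subset {B : Set ℝ} (hB : BddBelow B) {t : ℝ}
    (h : Set.Iio t ∩ A ⊆ B) : timeBefore A t ≤ timeBefore B t :=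
  measureReal_mono (Set.subset_inter Set.inter_subset_left h) (volume_Iio_inter_ne_top hB t)

lemma timeBefore_add (hA : BddBelow A) {a b : ℝ} (hab : a ≤ b) :
    timeBefore A b = timeBefore A a + volume.real (A ∩ Set.Ico a b) := by
  unfold timeBefore
  rw [← measureReal_inter_add_sdiff₀ measurableSet_Iio.nullMeasurableSet
    (volume_Iio_inter_ne_top hA b) (t := Set.Iio a)]
  congr 2 <;> grind

lemma timeBefore_mono (hA : BddBelow A) : Monotone (timeBefore A) := fun a b hab => by
  rw [timeBefore_add hA hab]
  exact le_add_of_nonneg_right measureReal_nonneg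

lemma continuous_timeBefore (hA : BddBelow A) : Continuous (timeBefore A) := by
  refine (LipschitzWith.of_le_add fun x y => ?_ : LipschitzWith 1 (timeBefore A)).continuous
  rcases le_total x y with h | h
  · exact (timeBefore_mono hA h).trans (le_add_of_nonneg_right dist_nonneg)
  · rw [timeBefore_add hA h]
    gcongr
    exact (volume_inter_Ico_le A h).trans (le_abs_self _)

lemma timeBefore_eq_zero {t : ℝ} (ht : t ∈ lowerBounds A) : timeBefore A t = 0 := by
  have : Set.Iio t ∩ A = ∅ := Set.eq_empty_of_forall_notMem fun u hu => (ht hu.2).not_gt hu.1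
  rw [timeBefore, this, measureReal_empty]

lemma exists_mul_timeBefore_eq (hA : BddBelow A) {s c t : ℝ} (hc : 0 ≤ c)
    (hct : c ≤ s * timeBefore A t) : ∃ t' ≤ t, s * timeBefore A t' = c := by
  obtain ⟨r, hr⟩ := hA
  have hmin : min r t ∈ lowerBounds A := fun u hu => (min_le_left r t).trans (hr hu)
  obtain ⟨t', ht', h⟩ := intermediate_value_Icc (min_le_right r t)
    ((continuous_timeBefore ⟨r, hr⟩).const_mul s).continuousOn
    ⟨by simpa only [timeBefore_eq_zero hmin, mul_zero] using hc, hct⟩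
  exact ⟨t', ht'.2, h⟩

lemma mul_timeBefore_le (hA : BddBelow A) {s c : ℝ} (hs : 0 ≤ s) (hc : 0 ≤ c)
    (h : ∀ u ∈ A, s * timeBefore A u < c) (t : ℝ) : s * timeBefore A t ≤ c := by
  by_contra! hlt
  obtain ⟨t', ht', hc'⟩ := exists_mul_timeBefore_eq hA hc hlt.le
  have hempty : A ∩ Set.Ico t' t = ∅ := Set.eq_empty_of_forall_notMem fun u hu =>
    (h u hu.1).not_ge (hc' ▸ mul_le_mul_of_nonneg_left (timeBefore_mono hA hu.2.1) hs)
  rw [timeBefore_add hA ht', hempty, measureReal_empty, add_zero] at hlt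
  exact hlt.ne' hc'

lemma le_mul_timeBefore_diff_iff (hA : BddBelow A) {s e t : ℝ} (hs : 0 ≤ s) :
    e ≤ s * timeBefore (A \ {u | e ≤ s * timeBefore A u}) t ↔ e ≤ s * timeBefore A t := by
  set A' := A \ {u | e ≤ s * timeBefore A u}
  have hA' : BddBelow A' := hA.mono Set.sdiff_subset
  constructor
  · intro h
    exact h.trans (mul_le_mul_of_nonneg_left
      (timeBefore_le_of_subset hA (Set.inter_subset_right.trans Set.sdiff_subset)) hs)
  · intro h
    by_contra! hlt
    -- `A` and `A'` agree up to a time `t'` at which `s * timeBefore A` lies strictly between.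
    obtain ⟨c, hc, hce⟩ := exists_between hlt
    obtain ⟨t', ht', hc'⟩ := exists_mul_timeBefore_eq hA
      ((mul_nonneg hs (timeBefore_nonneg A' t)).trans hc.le) (hce.le.trans h)
    have hsub : Set.Iio t' ∩ A ⊆ A' := fun u hu => ⟨hu.2, fun hue => hce.not_ge
      (hc' ▸ hue.trans (mul_le_mul_of_nonneg_left (timeBefore_mono hA (le_of_lt hu.1)) hs))⟩
    refine hc.not_ge ?_
    rw [← hc']
    exact mul_le_mul_of_nonneg_left
      ((timeBefore_le_of_subset hA' hsub).trans (timeBefore_mono hA' ht')) hs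

lemma sum_volume_inter_Ico_le {ι : Type*} {F : Finset ι} {E : ι → Set ℝ} {a b : ℝ} (hab : a ≤ b)
    (hE : ∀ i ∈ F, MeasurableSet (E i)) (hd : (F : Set ι).PairwiseDisjoint E) :
    ∑ i ∈ F, volume.real (E i ∩ Set.Ico a b) ≤ b - a := by
  rw [← measureReal_biUnion_finset
    (fun i hi j hj hij => (hd hi hj hij).mono Set.inter_subset_left Set.inter_subset_left)
    (fun i hi => (hE i hi).inter measurableSet_Ico) (fun i _ => volume_inter_Ico_ne_top _ a b),
    ← Set.iUnion₂_inter]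
  exact volume_inter_Ico_le _ hab

open Classical in
lemma mul_measureReal_le_sum {α ι : Type*} [MeasurableSpace α] {μ : Measure α} {F : Finset ι}
    {E : ι → Set α} {w : ι → ℝ} {S : Set α} {c : ℝ} (hE : ∀ i ∈ F, MeasurableSet (E i))
    (hS : MeasurableSet S) (hμ : μ S ≠ ⊤) (h : ∀ t ∈ S, c ≤ ∑ i ∈ F with t ∈ E i, w i) :
    c * μ.real S ≤ ∑ i ∈ F, w i * μ.real (E i ∩ S) := by
  have hint : ∀ i ∈ F, IntegrableOn ((E i).indicator fun _ => w i) S μ :=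
    fun i hi => (integrableOn_const hμ).indicator (hE i hi)
  calc c * μ.real S = ∫ _ in S, c ∂μ := by rw [setIntegral_const, smul_eq_mul, mul_comm]
    _ ≤ ∫ t in S, ∑ i ∈ F, (E i).indicator (fun _ => w i) t ∂μ :=
      setIntegral_mono_on (integrableOn_const hμ) (integrable_finsetSum F hint) hS fun t ht => by
        simpa only [Finset.sum_filter, Set.indicator_apply] using h t ht
    _ = ∑ i ∈ F, w i * μ.real (E i ∩ S) := by
      rw [integral_finsetSum F hint]
      refine Finset.sum_congr rfl fun i hi => ?_
      rw [integral_indicator_const _ (hE i hi), measureReal_restrict_apply (hE i hi), smul_eq_mul,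
        mul_comm]

end Measure

section Valid

variable {M N : ℕ} {σ : Schedule M N} {s : ℝ} {J : JobSeq N} {τ : TaskSet N}

lemma Schedule.IsValid.measurableSet_runs (h : σ.IsValid s J) (i : Fin N) (j : ℕ) :
    MeasurableSet {t | σ.Runs i j t} := by
  simp only [Schedule.Runs, Set.ofPred_exists]
  exact MeasurableSet.iUnion fun p => h.measurable p i j

lemma Schedule.IsValid.bddBelow_runs (h : σ.IsValid s J) (i : Fin N) (j : ℕ) :
    BddBelow {t | σ.Runs i j t} := ⟨J.release i j, fun t ht => h.arrived i j t ht⟩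

lemma Schedule.IsValid.service_le (h : σ.IsValid s J) (hs : 0 ≤ s) (hJ : J.IsLegal τ) (i : Fin N)
    (j : ℕ) (t : ℝ) : σ.service s i j t ≤ (τ i).C :=
  (mul_timeBefore_le (h.bddBelow_runs i j) hs (hJ.exec_nonneg i j)
    (fun u hu => not_le.1 (h.unfinished i j u hu)) t).trans (hJ.exec_le i j)

lemma Schedule.IsValid.finished_mono (h : σ.IsValid s J) (hs : 0 ≤ s) {i : Fin N} {j : ℕ}
    {t t' : ℝ} (htt : t ≤ t') (hf : σ.Finished s J i j t) : σ.Finished s J i j t' :=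
  hf.trans (mul_le_mul_of_nonneg_left (timeBefore_mono (h.bddBelow_runs i j) htt) hs)

lemma Schedule.IsValid.le_of_runs (h : σ.IsValid s J) (hs : 0 ≤ s) {i : Fin N} {m j : ℕ}
    {u t : ℝ} (hm : ∀ j < m, σ.Finished s J i j u) (hut : u ≤ t) (hr : σ.Runs i j t) : m ≤ j :=
  not_lt.1 fun hjm => h.unfinished i j t hr (h.finished_mono hs hut (hm j hjm))

lemma Schedule.IsValid.exec_le_mul_volume (h : σ.IsValid s J) (hs : 0 ≤ s)
    (hd : σ.MeetsDeadlines s τ J) {i : Fin N} {j : ℕ} {a b : ℝ} (ha : a ≤ J.release i j)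
    (hb : J.release i j + (τ i).D ≤ b) :
    J.exec i j ≤ s * volume.real ({t | σ.Runs i j t} ∩ Set.Ico a b) :=
  (hd i j).trans <| mul_le_mul_of_nonneg_left (measureReal_mono
    (fun u hu => ⟨hu.2, ha.trans (h.arrived i j u hu.2), lt_of_lt_of_le hu.1 hb⟩)
    (volume_inter_Ico_ne_top _ a b)) hs

lemma Schedule.IsValid.sum_volume_runs_task_le (h : σ.IsValid s J) (i : Fin N) (F : Finset ℕ)
    {a b : ℝ} (hab : a ≤ b) :
    ∑ j ∈ F, volume.real ({t | σ.Runs i j t} ∩ Set.Ico a b) ≤ b - a := by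
  refine sum_volume_inter_Ico_le hab (fun j _ => h.measurableSet_runs i j) fun j _ j' _ hj =>
    Set.disjoint_left.2 ?_
  rintro t ⟨p, hp⟩ ⟨q, hq⟩
  obtain rfl := h.sequential p q t i j j' hp hq
  exact hj (Prod.mk.inj (Option.some.inj (hp.symm.trans hq))).2

lemma Schedule.IsValid.sum_volume_runs_le (h : σ.IsValid s J) (F : Finset (Fin N × ℕ))
    {a b : ℝ} (hab : a ≤ b) :
    ∑ x ∈ F, volume.real ({t | σ.Runs x.1 x.2 t} ∩ Set.Ico a b) ≤ M * (b - a) := by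
  calc ∑ x ∈ F, volume.real ({t | σ.Runs x.1 x.2 t} ∩ Set.Ico a b)
      ≤ ∑ x ∈ F, ∑ p, volume.real ({t | σ p t = some x} ∩ Set.Ico a b) := by
        refine Finset.sum_le_sum fun x _ => ?_
        simp only [Schedule.Runs, Set.ofPred_exists, Set.iUnion_inter]
        exact measureReal_iUnion_fintype_le _
    _ = ∑ p, ∑ x ∈ F, volume.real ({t | σ p t = some x} ∩ Set.Ico a b) := Finset.sum_comm
    _ ≤ ∑ _p : Fin M, (b - a) := Finset.sum_le_sum fun p _ =>
        sum_volume_inter_Ico_le hab (fun x _ => h.measurable p x.1 x.2) fun x _ y _ hxy =>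
          Set.disjoint_left.2 fun t hx hy => hxy (Option.some.inj (hx.symm.trans hy))
    _ = M * (b - a) := by rw [Finset.sum_const, Finset.card_fin, nsmul_eq_mul]

end Valid

section Feasible

variable {M N : ℕ} {τ : TaskSet N}

/-- The synchronous periodic job sequence of a task set, with worst-case execution times. The
demand of its jobs is what feasibility is tested against. -/
def periodicJobs (τ : TaskSet N) : JobSeq N where
  release i j := j * (τ i).T
  exec i _ := (τ i).C

lemma periodicJobs_isLegal (τ : TaskSet N) : (periodicJobs τ).IsLegal τ where
  separation i j := by
    simp only [periodicJobs, Nat.cast_add_one]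
    linarith
  exec_nonneg i _ := (τ i).C_pos.le
  exec_le _ _ := le_rfl

lemma Feasible.exists_schedule_periodicJobs (h : Feasible M 1 τ) :
    ∃ σ : Schedule M N, σ.IsValid 1 (periodicJobs τ) ∧
      ∀ i (j : ℕ) (t : ℝ), j * (τ i).T + (τ i).D ≤ t →
        (τ i).C ≤ volume.real ({u | σ.Runs i j u} ∩ Set.Ico 0 t) := by
  obtain ⟨σ, hv, hd⟩ := h _ (periodicJobs_isLegal τ)
  refine ⟨σ, hv, fun i j t ht => ?_⟩
  exact (hv.exec_le_mul_volume zero_le_one hd (mul_nonneg j.cast_nonneg (τ i).T_pos.le) ht).trans_eq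
    (one_mul _)

lemma Feasible.sum_C_jobs_le (h : Feasible M 1 τ) (F : Finset (Fin N × ℕ)) {t : ℝ} (h0 : 0 ≤ t)
    (hF : ∀ x ∈ F, x.2 * (τ x.1).T + (τ x.1).D ≤ t) : ∑ x ∈ F, (τ x.1).C ≤ M * t := by
  obtain ⟨σ, hv, hC⟩ := h.exists_schedule_periodicJobs
  simpa only [sub_zero] using
    (Finset.sum_le_sum fun x hx => hC x.1 x.2 t (hF x hx)).trans (hv.sum_volume_runs_le F h0)

lemma Feasible.add_one_mul_C_le (h : Feasible M 1 τ) (i : Fin N) (n : ℕ) :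
    (n + 1) * (τ i).C ≤ n * (τ i).T + (τ i).D := by
  obtain ⟨σ, hv, hC⟩ := h.exists_schedule_periodicJobs
  set t := n * (τ i).T + (τ i).D
  have h0 : 0 ≤ t := add_nonneg (mul_nonneg n.cast_nonneg (τ i).T_pos.le) (τ i).D_pos.le
  have hdeadline : ∀ j ∈ Finset.range (n + 1), j * (τ i).T + (τ i).D ≤ t := fun j hj => by
    have hjn : j ≤ n := Nat.lt_succ_iff.1 (Finset.mem_range.1 hj)
    have := (τ i).T_pos
    simp only [t]
    gcongr
  calc (n + 1) * (τ i).C = ∑ _j ∈ Finset.range (n + 1), (τ i).C := by simp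
    _ ≤ ∑ j ∈ Finset.range (n + 1), volume.real ({u | σ.Runs i j u} ∩ Set.Ico 0 t) :=
        Finset.sum_le_sum fun j hj => hC i j t (hdeadline j hj)
    _ ≤ t - 0 := hv.sum_volume_runs_task_le i _ h0
    _ = t := sub_zero t

lemma le_of_forall_mul_le_mul_add {K : Type*} [Field K] [LinearOrder K] [IsStrictOrderedRing K]
    [Archimedean K] {a b c : K} (h : ∀ n : ℕ, n * a ≤ n * b + c) : a ≤ b := by
  by_contra! hlt
  obtain ⟨n, hn⟩ := exists_nat_gt (c / (a - b))
  rw [div_lt_iff₀ (sub_pos.2 hlt)] at hn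
  linarith [h n]

lemma Feasible.C_le_T (h : Feasible M 1 τ) (i : Fin N) : (τ i).C ≤ (τ i).T :=
  le_of_forall_mul_le_mul_add (c := (τ i).D) fun n => by
    linarith [h.add_one_mul_C_le i n, (τ i).C_pos]

lemma Feasible.sum_C_le (h : Feasible M 1 τ) (H : Finset (Fin N)) {d : ℝ} (h0 : 0 ≤ d)
    (hH : ∀ i ∈ H, (τ i).D ≤ d) : ∑ i ∈ H, (τ i).C ≤ M * d := by
  simpa [Finset.sum_product] using h.sum_C_jobs_le (H ×ˢ {0}) h0 (by simpa using hH)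

lemma Feasible.sum_utilization_le (h : Feasible M 1 τ) : ∑ i, (τ i).C / (τ i).T ≤ M := by
  set D := ∑ i, (τ i).D
  have hD : ∀ i, (τ i).D ≤ D :=
    fun i => Finset.single_le_sum (fun k _ => (τ k).D_pos.le) (Finset.mem_univ i)
  have h0 : 0 ≤ D := Finset.sum_nonneg fun k _ => (τ k).D_pos.le
  refine le_of_forall_mul_le_mul_add (c := M * D) fun n => ?_
  -- All jobs released before time `n` have their deadlines at most at time `n + D`.
  let jobs i := Finset.range ⌈n / (τ i).T⌉₊
  let F : Finset (Fin N × ℕ) := Finset.univ.biUnion fun i => (jobs i).image (i, ·)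
  have hmem : ∀ x, x ∈ F ↔ x.1 ∈ Finset.univ ∧ x.2 ∈ jobs x.1 := by simp [F, Prod.ext_iff]
  have hdeadline : ∀ x ∈ F, x.2 * (τ x.1).T + (τ x.1).D ≤ n + D := fun x hx => by
    have hrelease := Nat.lt_ceil.1 (Finset.mem_range.1 ((hmem x).1 hx).2)
    exact add_le_add ((lt_div_iff₀ (τ x.1).T_pos).1 hrelease).le (hD x.1)
  calc n * ∑ i, (τ i).C / (τ i).T
      = ∑ i, n / (τ i).T * (τ i).C := by
        rw [Finset.mul_sum]
        exact Finset.sum_congr rfl fun i _ => by ring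
    _ ≤ ∑ i, ⌈n / (τ i).T⌉₊ * (τ i).C := Finset.sum_le_sum fun i _ =>
        mul_le_mul_of_nonneg_right (Nat.le_ceil _) (τ i).C_pos.le
    _ = ∑ x ∈ F, (τ x.1).C := by
        rw [Finset.sum_finset_product F Finset.univ jobs hmem]
        simp [jobs]
    _ ≤ M * (n + D) := h.sum_C_jobs_le F (by positivity) hdeadline
    _ = n * M + M * D := by ring

lemma Feasible.sum_C_add_utilization_mul_le (h : Feasible M 1 τ) (H : Finset (Fin N)) {d x : ℝ}
    (hd : 0 ≤ d) (hH : ∀ i ∈ H, (τ i).D ≤ d) (hx : 0 ≤ x) :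
    ∑ i ∈ H, ((τ i).C + (τ i).C / (τ i).T * x) ≤ M * d + M * x := by
  rw [Finset.sum_add_distrib, ← Finset.sum_mul]
  have hutilization : ∑ i ∈ H, (τ i).C / (τ i).T ≤ M :=
    (Finset.sum_le_sum_of_subset_of_nonneg H.subset_univ
      fun i _ _ => div_nonneg (τ i).C_pos.le (τ i).T_pos.le).trans h.sum_utilization_le
  exact add_le_add (h.sum_C_le H hd hH) (mul_le_mul_of_nonneg_right hutilization hx)

end Feasible

section Legal

variable {N : ℕ} {J : JobSeq N} {τ : TaskSet N}

lemma JobSeq.IsLegal.release_add_le (h : J.IsLegal τ) (i : Fin N) (j n : ℕ) :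
    J.release i j + n * (τ i).T ≤ J.release i (j + n) := by
  induction n with
  | zero => simp
  | succ n ih =>
    have := h.separation i (j + n)
    rw [← add_assoc]
    push_cast
    linarith

lemma JobSeq.IsLegal.release_mono (h : J.IsLegal τ) (i : Fin N) : Monotone (J.release i) :=
  monotone_nat_of_le_succ fun j => by linarith [h.separation i j, (τ i).T_pos]

lemma JobSeq.IsLegal.le_release_add_ceil (h : J.IsLegal τ) {i : Fin N} {m : ℕ} {a : ℝ}
    (ha : a ≤ J.release i m) (b : ℝ) : b ≤ J.release i (m + ⌈(b - a) / (τ i).T⌉₊) := by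
  have := (div_le_iff₀ (τ i).T_pos).1 (Nat.le_ceil ((b - a) / (τ i).T))
  linarith [h.release_add_le i m ⌈(b - a) / (τ i).T⌉₊]

lemma JobSeq.IsLegal.exists_forall_le_release (h : J.IsLegal τ) :
    ∃ B, ∀ i j, B ≤ J.release i j := by
  obtain ⟨B, hB⟩ := (Set.finite_range fun i => J.release i 0).bddBelow
  exact ⟨B, fun i j => (hB ⟨i, rfl⟩).trans (h.release_mono i (Nat.zero_le j))⟩

end Legal

section RunTime

variable {M N : ℕ} {σ : Schedule M N} {s : ℝ} {J : JobSeq N} {τ : TaskSet N} {i : Fin N}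

/-- Some job of task `i` executes at time `t`. -/
def Schedule.RunsTask (σ : Schedule M N) (i : Fin N) (t : ℝ) : Prop := ∃ j, σ.Runs i j t

/-- Length of time during which task `i` executes in the interval `[a, b)`. -/
noncomputable def Schedule.runTime (σ : Schedule M N) (i : Fin N) (a b : ℝ) : ℝ :=
  volume.real ({t | σ.RunsTask i t} ∩ Set.Ico a b)

/-- Task `i` has an arrived but unfinished job at time `t`. -/
def Schedule.Pending (σ : Schedule M N) (s : ℝ) (J : JobSeq N) (i : Fin N) (t : ℝ) : Prop :=
  ∃ j, J.release i j ≤ t ∧ ¬ σ.Finished s J i j t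

lemma Schedule.runTime_add (σ : Schedule M N) (i : Fin N) {a b c : ℝ} (hab : a ≤ b)
    (hbc : b ≤ c) : σ.runTime i a c = σ.runTime i a b + σ.runTime i b c :=
  volume_inter_Ico_add _ hab hbc

lemma Schedule.IsValid.measurableSet_runsTask (h : σ.IsValid s J) (i : Fin N) :
    MeasurableSet {t | σ.RunsTask i t} := by
  simp only [Schedule.RunsTask, Set.ofPred_exists]
  exact MeasurableSet.iUnion fun j => h.measurableSet_runs i j

lemma Schedule.IsValid.bddBelow_runsTask (h : σ.IsValid s J) (hJ : J.IsLegal τ) (i : Fin N) :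
    BddBelow {t | σ.RunsTask i t} :=
  ⟨J.release i 0, fun t ⟨j, hj⟩ => (hJ.release_mono i j.zero_le).trans (h.arrived i j t hj)⟩

lemma Schedule.IsValid.continuousOn_runTime (h : σ.IsValid s J) (hJ : J.IsLegal τ) (i : Fin N)
    (d : ℝ) : ContinuousOn (σ.runTime i · d) (Set.Iic d) := by
  have hA := h.bddBelow_runsTask hJ i
  have hcont : Continuous fun t => timeBefore {t | σ.RunsTask i t} d -
      timeBefore {t | σ.RunsTask i t} t := continuous_const.sub (continuous_timeBefore hA)
  exact hcont.continuousOn.congr fun t ht => eq_sub_of_add_eq' (timeBefore_add hA ht).symm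

lemma Schedule.IsValid.mul_runTime_le_sum_service (h : σ.IsValid s J) (hs : 0 ≤ s) {a b : ℝ}
    {F : Finset ℕ} (hF : ∀ t ∈ Set.Ico a b, ∀ j, σ.Runs i j t → j ∈ F) :
    s * σ.runTime i a b ≤ ∑ j ∈ F, σ.service s i j b := by
  have hsub : {t | σ.RunsTask i t} ∩ Set.Ico a b ⊆
      ⋃ j ∈ F, Set.Iio b ∩ {t | σ.Runs i j t} := by
    rintro t ⟨⟨j, hj⟩, ht⟩
    exact Set.mem_biUnion (hF t ht j hj) ⟨ht.2, hj⟩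
  have hfinite : volume (⋃ j ∈ F, Set.Iio b ∩ {t | σ.Runs i j t}) ≠ ⊤ :=
    (measure_biUnion_lt_top F.finite_toSet fun j _ =>
      (volume_Iio_inter_ne_top (h.bddBelow_runs i j) b).lt_top).ne
  calc s * σ.runTime i a b
      ≤ s * ∑ j ∈ F, volume.real (Set.Iio b ∩ {t | σ.Runs i j t}) :=
        mul_le_mul_of_nonneg_left
          ((measureReal_mono hsub hfinite).trans (measureReal_biUnion_finset_le _ _)) hs
    _ = ∑ j ∈ F, σ.service s i j b := Finset.mul_sum _ _ _

/-- The start of the busy period of a task that ends at `t` is the arrival of its job `m`, or `t`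
itself if the task is not pending just before `t`. -/
lemma Schedule.IsValid.exists_pending_from (h : σ.IsValid s J) (hs : 0 ≤ s) (hJ : J.IsLegal τ)
    (i : Fin N) (t : ℝ) :
    ∃ m, (∀ x ∈ Set.Ico (J.release i m) t, σ.Pending s J i x) ∧
      ∀ j < m, σ.Finished s J i j (min t (J.release i m)) := by
  classical
  have hex : ∃ m, ∀ x ∈ Set.Ico (J.release i m) t, σ.Pending s J i x :=
    ⟨0 + ⌈(t - J.release i 0) / (τ i).T⌉₊,
      fun x hx => absurd ((hJ.le_release_add_ceil le_rfl t).trans hx.1) hx.2.not_ge⟩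
  refine ⟨Nat.find hex, Nat.find_spec hex, fun j hj => ?_⟩
  -- The minimal choice of `m` gives a time in `[r (m - 1), min t (r m))` without pending jobs.
  obtain ⟨x, hx, hidle⟩ : ∃ x ∈ Set.Ico (J.release i (Nat.find hex - 1)) t,
      ¬ σ.Pending s J i x := by
    simpa only [not_forall, exists_prop] using
      Nat.find_min hex (Nat.sub_one_lt (Nat.ne_zero_of_lt hj))
  have hxm : x < J.release i (Nat.find hex) := by
    by_contra! hle
    exact hidle (Nat.find_spec hex x ⟨hle, hx.2⟩)
  have harrived : J.release i j ≤ x := (hJ.release_mono i (Nat.le_sub_one_of_lt hj)).trans hx.1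
  exact h.finished_mono hs (le_min hx.2.le hxm.le)
    (not_not.1 fun hf => hidle ⟨j, harrived, hf⟩)

lemma Schedule.IsValid.mul_runTime_lt_of_finished (h : σ.IsValid s J) (hs : 0 ≤ s)
    (hJ : J.IsLegal τ) {u d : ℝ} (hud : u ≤ d) {m : ℕ}
    (hm : ∀ j < m, σ.Finished s J i j u) (hum : u ≤ J.release i m) :
    s * σ.runTime i u d < (τ i).C + (τ i).C / (τ i).T * (d - u) := by
  set n := ⌈(d - u) / (τ i).T⌉₊
  have hjobs : ∀ t ∈ Set.Ico u d, ∀ j, σ.Runs i j t → j ∈ Finset.Ico m (m + n) := by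
    refine fun t ht j hr => Finset.mem_Ico.2 ⟨h.le_of_runs hs hm ht.1 hr, ?_⟩
    by_contra! hle
    exact ht.2.not_ge ((hJ.le_release_add_ceil hum d).trans
      ((hJ.release_mono i hle).trans (h.arrived i j t hr)))
  calc s * σ.runTime i u d ≤ ∑ j ∈ Finset.Ico m (m + n), σ.service s i j d :=
        h.mul_runTime_le_sum_service hs hjobs
    _ ≤ ∑ _j ∈ Finset.Ico m (m + n), (τ i).C :=
        Finset.sum_le_sum fun j _ => h.service_le hs hJ i j d
    _ = n * (τ i).C := by simp
    _ < ((d - u) / (τ i).T + 1) * (τ i).C :=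
        mul_lt_mul_of_pos_right
          (Nat.ceil_lt_add_one (div_nonneg (sub_nonneg.2 hud) (τ i).T_pos.le)) (τ i).C_pos
    _ = (τ i).C + (τ i).C / (τ i).T * (d - u) := by ring

lemma Schedule.IsValid.mul_runTime_lt_of_rate (h : σ.IsValid s J) (hs : 0 ≤ s)
    (hJ : J.IsLegal τ) {t d : ℝ} (htd : t ≤ d)
    (hrate : ∀ m, J.release i m ≤ t →
      (∀ x ∈ Set.Ico (J.release i m) t, σ.Pending s J i x) →
      (τ i).C / (τ i).T * (t - J.release i m) ≤ s * σ.runTime i (J.release i m) t) :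
    s * σ.runTime i t d < (τ i).C + (τ i).C / (τ i).T * (d - t) := by
  obtain ⟨m, hpend, hm⟩ := h.exists_pending_from hs hJ i t
  rcases le_total t (J.release i m) with hle | hle
  · rw [min_eq_left hle] at hm
    exact h.mul_runTime_lt_of_finished hs hJ htd hm hle
  · rw [min_eq_right hle] at hm
    have htotal := h.mul_runTime_lt_of_finished hs hJ (hle.trans htd) hm le_rfl
    rw [σ.runTime_add i hle htd] at htotal
    linarith [hrate m hle hpend]

lemma Schedule.IsValid.exists_first_le_sum_runTime (h : σ.IsValid s J) (hJ : J.IsLegal τ)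
    (H : Finset (Fin N)) (c : ℝ) {B u d : ℝ} (hBu : B ≤ u) (hud : u ≤ d)
    (hu : c * (d - u) ≤ s * ∑ i ∈ H, σ.runTime i u d) :
    ∃ t ∈ Set.Icc B u, c * (d - t) ≤ s * ∑ i ∈ H, σ.runTime i t d ∧
      ∀ v ∈ Set.Ico B t, s * ∑ i ∈ H, σ.runTime i v d < c * (d - v) := by
  have hcont : ContinuousOn (fun t => s * ∑ i ∈ H, σ.runTime i t d) (Set.Icc B u) :=
    continuousOn_const.mul <| continuousOn_finsetSum H fun i _ =>
      (h.continuousOn_runTime hJ i d).mono fun t ht => ht.2.trans hud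
  have hclosed : IsClosed {t ∈ Set.Icc B u | c * (d - t) ≤ s * ∑ i ∈ H, σ.runTime i t d} :=
    isClosed_Icc.isClosed_le (by fun_prop) hcont
  obtain ⟨t, ht, hmin⟩ := (isCompact_Icc.of_isClosed_subset hclosed
    (Set.sep_subset _ _)).exists_isLeast ⟨u, ⟨hBu, le_rfl⟩, hu⟩
  exact ⟨t, ht.1, ht.2, fun v hv => not_le.1 fun hle =>
    hv.2.not_ge (hmin ⟨⟨hv.1, hv.2.le.trans ht.1.2⟩, hle⟩)⟩

end RunTime

section FixedPriority

variable {M N : ℕ} {σ : Schedule M N} {s : ℝ} {J : JobSeq N} {τ : TaskSet N}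
  {prio : PriorityRule} {i : Fin N}

open Classical in
lemma le_card_higher_of_pending (h : globalFixedPriority M prio N τ s J σ) (hJ : J.IsLegal τ)
    {t : ℝ} (hp : σ.Pending s J i t) (hi : ¬ σ.RunsTask i t) :
    M ≤ Finset.card {k | prio N τ k < prio N τ i ∧ σ.RunsTask k t} := by
  have hex : ∃ j, ¬ σ.Finished s J i j t := hp.imp fun _ hj => hj.2
  obtain ⟨j₀, harrived, hunfinished⟩ := hp
  have hready : σ.Ready s J i (Nat.find hex) t :=
    ⟨(hJ.release_mono i (Nat.find_min' hex hunfinished)).trans harrived, Nat.find_spec hex,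
      fun j hj => not_not.1 (Nat.find_min hex hj)⟩
  choose f g hrun hlt using h.2.2 i _ t hready fun hr => hi ⟨_, hr⟩
  have hf : Function.Injective f := fun p q hpq =>
    h.1.sequential p q t (f p) (g p) (g q) (hrun p) (hpq ▸ hrun q)
  simpa only [Finset.card_fin] using Finset.card_le_card_of_injOn (s := Finset.univ) f
    (fun p _ => Finset.mem_filter.2 ⟨Finset.mem_univ _, hlt p, g p, p, hrun p⟩) hf.injOn

lemma mul_le_sum_runTime_of_pending (h : globalFixedPriority M prio N τ s J σ)
    (hJ : J.IsLegal τ) {H : Finset (Fin N)} (hH : ∀ k, prio N τ k ≤ prio N τ i → k ∈ H)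
    {a b : ℝ} (hab : a ≤ b) (hp : ∀ t ∈ Set.Ico a b, σ.Pending s J i t) :
    M * (b - a) ≤ ∑ k ∈ H, σ.runTime k a b + (M - 1) * σ.runTime i a b := by
  classical
  have hi : i ∈ H := hH i le_rfl
  -- With weight `M` for `i` and `1` for the others, the running tasks of `H` always weigh `≥ M`.
  let w : Fin N → ℝ := fun k => 1 + if k = i then (M : ℝ) - 1 else 0
  have hwi : w i = M := by simp [w]
  have hw : ∀ k ≠ i, w k = 1 := fun k hk => by simp [w, hk]
  have hw0 : ∀ k, 0 ≤ w k := fun k => by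
    rcases eq_or_ne k i with rfl | hk
    · exact hwi ▸ M.cast_nonneg
    · exact hw k hk ▸ zero_le_one
  have hweight : ∀ t ∈ Set.Ico a b, (M : ℝ) ≤ ∑ k ∈ H with σ.RunsTask k t, w k := by
    intro t ht
    by_cases hrun : σ.RunsTask i t
    · rw [← hwi]
      exact Finset.single_le_sum (fun k _ => hw0 k) (Finset.mem_filter.2 ⟨hi, hrun⟩)
    · have hsub : ({k | prio N τ k < prio N τ i ∧ σ.RunsTask k t} : Finset (Fin N)) ⊆
          {k ∈ H | σ.RunsTask k t} := by grind
      have hone : ∀ k ∈ H.filter (σ.RunsTask · t), w k = 1 := fun k hk =>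
        hw k fun hki => hrun (hki ▸ (Finset.mem_filter.1 hk).2)
      rw [Finset.sum_congr rfl hone, Finset.sum_const, nsmul_one, Nat.cast_le]
      exact (le_card_higher_of_pending h hJ (hp t ht) hrun).trans (Finset.card_le_card hsub)
  calc M * (b - a) = M * volume.real (Set.Ico a b) := by rw [Real.volume_real_Ico_of_le hab]
    _ ≤ ∑ k ∈ H, w k * σ.runTime k a b :=
        mul_measureReal_le_sum (fun k _ => h.1.measurableSet_runsTask k) measurableSet_Ico
          measure_Ico_lt_top.ne hweight
    _ = ∑ k ∈ H, σ.runTime k a b + (M - 1) * σ.runTime i a b := by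
        simp [w, add_mul, Finset.sum_add_distrib, hi]

lemma exists_pending_of_miss (h : globalFixedPriority M prio N τ s J σ) (hs : 0 ≤ s)
    (hJ : J.IsLegal τ) (hF : Feasible M 1 τ) {j : ℕ}
    (hmiss : ¬ σ.Finished s J i j (J.release i j + (τ i).D)) :
    ∃ m ≤ j, (∀ t ∈ Set.Ico (J.release i m) (J.release i j + (τ i).D), σ.Pending s J i t) ∧
      s * σ.runTime i (J.release i m) (J.release i j + (τ i).D) <
        J.release i j + (τ i).D - J.release i m := by
  have hv := h.1
  set d := J.release i j + (τ i).D with hd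
  obtain ⟨m, hpend, hm⟩ := hv.exists_pending_from hs hJ i d
  have hmj : m ≤ j := not_lt.1 fun hlt => hmiss (hv.finished_mono hs (min_le_left _ _) (hm j hlt))
  have hmd : J.release i m ≤ d := by linarith [hJ.release_mono i hmj, (τ i).D_pos]
  rw [min_eq_right hmd] at hm
  have hjobs : ∀ t ∈ Set.Ico (J.release i m) d, ∀ j', σ.Runs i j' t → j' ∈ Finset.Icc m j := by
    refine fun t ht j' hr => Finset.mem_Icc.2 ⟨hv.le_of_runs hs hm ht.1 hr, ?_⟩
    by_contra! hlt
    exact hmiss (hv.finished_mono hs ht.2.le ((h.2.1 i j' t hr).2.2 j hlt))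
  refine ⟨m, hmj, hpend, ?_⟩
  obtain ⟨l, rfl⟩ := Nat.exists_eq_add_of_le hmj
  calc s * σ.runTime i (J.release i m) d
      ≤ ∑ j' ∈ Finset.Icc m (m + l), σ.service s i j' d := hv.mul_runTime_le_sum_service hs hjobs
    _ < ∑ _j' ∈ Finset.Icc m (m + l), (τ i).C :=
        Finset.sum_lt_sum (fun j' _ => hv.service_le hs hJ i j' d)
          ⟨m + l, Finset.mem_Icc.2 ⟨hmj, le_rfl⟩,
            (not_le.1 hmiss).trans_le (hJ.exec_le i (m + l))⟩
    _ = (l + 1) * (τ i).C := by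
        have hcard : m + l + 1 - m = l + 1 := by omega
        rw [Finset.sum_const, Nat.card_Icc, hcard, nsmul_eq_mul, Nat.cast_add_one]
    _ ≤ l * (τ i).T + (τ i).D := hF.add_one_mul_C_le i l
    _ ≤ d - J.release i m := by linarith [hJ.release_add_le i m l]

lemma nonneg_of_three_sub_one_div_le (hM : 0 < M) (hs : 3 - 1 / (M : ℝ) ≤ s) : 0 ≤ s := by
  have : 1 / (M : ℝ) ≤ 1 := div_le_self zero_le_one (by exact_mod_cast hM)
  linarith

lemma mul_le_mul_sum_runTime_of_pending (h : globalFixedPriority M prio N τ s J σ) (hM : 0 < M)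
    (hs : 3 - 1 / (M : ℝ) ≤ s) (hJ : J.IsLegal τ) {H : Finset (Fin N)}
    (hH : ∀ k, prio N τ k ≤ prio N τ i → k ∈ H) {a b : ℝ} (hab : a ≤ b)
    (hp : ∀ t ∈ Set.Ico a b, σ.Pending s J i t) :
    (3 * M - 1) * (b - a) ≤
      s * ∑ k ∈ H, σ.runTime k a b + (M - 1) * (s * σ.runTime i a b) := by
  have hs0 := nonneg_of_three_sub_one_div_le hM hs
  have hMba : 0 ≤ M * (b - a) := mul_nonneg M.cast_nonneg (sub_nonneg.2 hab)
  calc (3 * M - 1) * (b - a) = (3 - 1 / M) * (M * (b - a)) := by field_simp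
    _ ≤ s * (M * (b - a)) := mul_le_mul_of_nonneg_right hs hMba
    _ ≤ s * (∑ k ∈ H, σ.runTime k a b + (M - 1) * σ.runTime i a b) :=
        mul_le_mul_of_nonneg_left (mul_le_sum_runTime_of_pending h hJ hH hab hp) hs0
    _ = s * ∑ k ∈ H, σ.runTime k a b + (M - 1) * (s * σ.runTime i a b) := by ring

lemma sub_le_mul_runTime_of_pending (h : globalFixedPriority M prio N τ s J σ) (hM : 0 < M)
    (hs : 3 - 1 / (M : ℝ) ≤ s) (hJ : J.IsLegal τ) {H : Finset (Fin N)}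
    (hH : ∀ k, prio N τ k ≤ prio N τ i → k ∈ H) {a b : ℝ} (hab : a ≤ b)
    (hp : ∀ t ∈ Set.Ico a b, σ.Pending s J i t)
    (hsum : s * ∑ k ∈ H, σ.runTime k a b < 2 * M * (b - a)) :
    b - a ≤ s * σ.runTime i a b := by
  have hM1 : (0 : ℝ) ≤ M - 1 := sub_nonneg.2 (by exact_mod_cast hM)
  have := mul_le_mul_sum_runTime_of_pending h hM hs hJ hH hab hp
  exact (lt_of_mul_lt_mul_left (by linarith) hM1).le

lemma exists_mul_le_sum_runTime_of_miss (h : globalFixedPriority M prio N τ s J σ) (hM : 0 < M)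
    (hs : 3 - 1 / (M : ℝ) ≤ s) (hJ : J.IsLegal τ) (hF : Feasible M 1 τ)
    {H : Finset (Fin N)} (hH : ∀ k, prio N τ k ≤ prio N τ i → k ∈ H) {j : ℕ} {d : ℝ}
    (hd : d = J.release i j + (τ i).D) (hmiss : ¬ σ.Finished s J i j d) :
    ∃ m ≤ j, 2 * M * (d - J.release i m) ≤ s * ∑ k ∈ H, σ.runTime k (J.release i m) d := by
  subst hd
  obtain ⟨m, hmj, hpend, hrun⟩ :=
    exists_pending_of_miss h (nonneg_of_three_sub_one_div_le hM hs) hJ hF hmiss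
  refine ⟨m, hmj, ?_⟩
  have hM1 : (0 : ℝ) ≤ M - 1 := sub_nonneg.2 (by exact_mod_cast hM)
  have hmd : J.release i m ≤ J.release i j + (τ i).D := by
    linarith [hJ.release_mono i hmj, (τ i).D_pos]
  linarith [mul_le_mul_sum_runTime_of_pending h hM hs hJ hH hmd hpend,
    mul_le_mul_of_nonneg_left hrun.le hM1]

lemma mul_runTime_lt_of_forall_sum_lt (h : globalFixedPriority M prio N τ s J σ) (hM : 0 < M)
    (hs : 3 - 1 / (M : ℝ) ≤ s) (hJ : J.IsLegal τ) (hF : Feasible M 1 τ)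
    {H : Finset (Fin N)} (hH : ∀ k, prio N τ k ≤ prio N τ i → k ∈ H) {B t d : ℝ}
    (hB : ∀ m, B ≤ J.release i m) (htd : t ≤ d)
    (hle : 2 * M * (d - t) ≤ s * ∑ k ∈ H, σ.runTime k t d)
    (hlt : ∀ v ∈ Set.Ico B t, s * ∑ k ∈ H, σ.runTime k v d < 2 * M * (d - v)) :
    s * σ.runTime i t d < (τ i).C + (τ i).C / (τ i).T * (d - t) := by
  have hs0 := nonneg_of_three_sub_one_div_le hM hs
  refine h.1.mul_runTime_lt_of_rate hs0 hJ htd fun m hmt hpend => ?_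
  set v := J.release i m
  have hrate : (τ i).C / (τ i).T * (t - v) ≤ t - v :=
    mul_le_of_le_one_left (sub_nonneg.2 hmt) ((div_le_one (τ i).T_pos).2 (hF.C_le_T i))
  refine hrate.trans ?_
  rcases hmt.eq_or_lt with heq | hvt
  · rw [heq, sub_self]
    exact mul_nonneg hs0 measureReal_nonneg
  · refine sub_le_mul_runTime_of_pending h hM hs hJ hH hmt hpend ?_
    have hsum := hlt v ⟨hB m, hvt⟩
    simp only [σ.runTime_add _ hmt htd, Finset.sum_add_distrib] at hsum
    linarith

lemma meetsDeadlines_of_globalFixedPriority (hDM : prio.IsDeadlineMonotonic) (hM : 0 < M)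
    (hs : 3 - 1 / (M : ℝ) ≤ s) (hF : Feasible M 1 τ) (hJ : J.IsLegal τ)
    (h : globalFixedPriority M prio N τ s J σ) : σ.MeetsDeadlines s τ J := by
  intro k j
  by_contra hmiss
  set d := J.release k j + (τ k).D with hd
  let H : Finset (Fin N) := {i | prio N τ i ≤ prio N τ k}
  have hmem : ∀ {i}, i ∈ H ↔ prio N τ i ≤ prio N τ k := by simp [H]
  have hupper : ∀ i ∈ H, ∀ i', prio N τ i' ≤ prio N τ i → i' ∈ H :=
    fun i hi i' hle => hmem.2 (hle.trans (hmem.1 hi))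
  have hDk : ∀ i ∈ H, (τ i).D ≤ (τ k).D := fun i hi => by
    rcases (hmem.1 hi).lt_or_eq with hlt | heq
    · exact hDM.monotone N τ i k hlt
    · rw [hDM.unique N τ heq]
  have hk : k ∈ H := hmem.2 le_rfl
  obtain ⟨B, hB⟩ := hJ.exists_forall_le_release
  obtain ⟨m, hmj, hm⟩ := exists_mul_le_sum_runTime_of_miss h hM hs hJ hF (hupper k hk) hd hmiss
  have hmd : J.release k m + (τ k).D ≤ d := add_le_add_left (hJ.release_mono k hmj) _
  obtain ⟨t, ht, hle, hlt⟩ := h.1.exists_first_le_sum_runTime hJ H (2 * M) (hB k m)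
    (by linarith [(τ k).D_pos]) hm
  have hDt : (τ k).D ≤ d - t := by linarith [ht.2]
  have hdt : 0 ≤ d - t := (τ k).D_pos.le.trans hDt
  have hreceived : s * ∑ i ∈ H, σ.runTime i t d <
      ∑ i ∈ H, ((τ i).C + (τ i).C / (τ i).T * (d - t)) := by
    rw [Finset.mul_sum]
    exact Finset.sum_lt_sum_of_nonempty ⟨k, hk⟩ fun i hi => mul_runTime_lt_of_forall_sum_lt h hM
      hs hJ hF (hupper i hi) (hB i) (sub_nonneg.1 hdt) hle hlt
  have hdemand := hF.sum_C_add_utilization_mul_le H (τ k).D_pos.le hDk hdt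
  linarith [mul_le_mul_of_nonneg_left hDt (Nat.cast_nonneg (α := ℝ) M)]

end FixedPriority

section SingleTask

variable {A : Set ℝ} {s : ℝ} {r e : ℕ → ℝ} {j : ℕ}

/-- The times at which job `j` of a task is finished, if the jobs arrive at the times `r`, need the
execution times `e`, and are served in order of arrival at speed `s` at all times in `A` at which
one of them is ready. -/
noncomputable def doneTimes (A : Set ℝ) (s : ℝ) (r e : ℕ → ℝ) (j : ℕ) : Set ℝ :=
  {t | e j ≤ s * timeBefore (A ∩ {u | r j ≤ u ∧ ∀ j' < j, u ∈ doneTimes A s r e j'}) t}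

/-- The times in `A` at which job `j` has arrived and all earlier jobs are finished, that is, the
times at which it could be served if it never finished. -/
def slots (A : Set ℝ) (s : ℝ) (r e : ℕ → ℝ) (j : ℕ) : Set ℝ :=
  A ∩ {u | r j ≤ u ∧ ∀ j' < j, u ∈ doneTimes A s r e j'}

/-- The times at which job `j` is served. -/
def serveTimes (A : Set ℝ) (s : ℝ) (r e : ℕ → ℝ) (j : ℕ) : Set ℝ :=
  slots A s r e j \ doneTimes A s r e j

lemma doneTimes_eq : doneTimes A s r e j = {t | e j ≤ s * timeBefore (slots A s r e j) t} := by
  rw [doneTimes, slots]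

lemma bddBelow_slots : BddBelow (slots A s r e j) := ⟨r j, fun _ ht => ht.2.1⟩

lemma isUpperSet_doneTimes (hs : 0 ≤ s) : IsUpperSet (doneTimes A s r e j) := by
  rw [doneTimes_eq]
  exact fun t t' htt ht =>
    le_trans ht (mul_le_mul_of_nonneg_left (timeBefore_mono bddBelow_slots htt) hs)

lemma measurableSet_serveTimes (hA : MeasurableSet A) (hs : 0 ≤ s) :
    MeasurableSet (serveTimes A s r e j) := by
  have hdone : ∀ j, MeasurableSet (doneTimes A s r e j) :=
    fun j => (isUpperSet_doneTimes hs).ordConnected.measurableSet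
  have hslots : MeasurableSet (slots A s r e j) := by
    simp only [slots, Set.ofPred_and, Set.ofPred_forall]
    exact hA.inter (measurableSet_Ici.inter
      (MeasurableSet.iInter fun j' => MeasurableSet.iInter fun _ => hdone j'))
  exact hslots.diff (hdone j)

lemma le_mul_timeBefore_serveTimes_iff (hs : 0 ≤ s) {t : ℝ} :
    e j ≤ s * timeBefore (serveTimes A s r e j) t ↔ t ∈ doneTimes A s r e j := by
  rw [serveTimes, doneTimes_eq]
  exact le_mul_timeBefore_diff_iff bddBelow_slots hs

lemma serveTimes_unique {j' : ℕ} {t : ℝ} (h : t ∈ serveTimes A s r e j)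
    (h' : t ∈ serveTimes A s r e j') : j = j' := by
  rcases lt_trichotomy j j' with hlt | heq | hlt
  · exact absurd (h'.1.2.2 j hlt) h.2
  · exact heq
  · exact absurd (h.1.2.2 j' hlt) h'.2

end SingleTask

section Construction

variable {M N : ℕ} {π : Fin N → ℕ} {s : ℝ} {J : JobSeq N} {i i' : Fin N} {j j' : ℕ} {t : ℝ}

/-- The times at which job `j` of task `i` executes under global fixed-priority scheduling with
priorities `π`, by recursion on the priority of the task: a task is served while fewer than `M`
tasks of higher priority are. -/
noncomputable def fixedPriorityTimes (M : ℕ) (π : Fin N → ℕ) (s : ℝ) (J : JobSeq N)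
    (i : Fin N) (j : ℕ) : Set ℝ :=
  serveTimes {t | {k | ∃ _ : π k < π i, ∃ j, t ∈ fixedPriorityTimes M π s J k j}.ncard < M}
    s (J.release i) (J.exec i) j
termination_by π i

/-- The tasks of higher priority than `i` that execute at time `t`. -/
def higherRunning (M : ℕ) (π : Fin N → ℕ) (s : ℝ) (J : JobSeq N) (i : Fin N) (t : ℝ) :
    Set (Fin N) :=
  {k | π k < π i ∧ ∃ j, t ∈ fixedPriorityTimes M π s J k j}

/-- The times at which some processor does not execute a task of higher priority than `i`. -/
def supply (M : ℕ) (π : Fin N → ℕ) (s : ℝ) (J : JobSeq N) (i : Fin N) : Set ℝ :=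
  {t | (higherRunning M π s J i t).ncard < M}

open Classical in
/-- The global fixed-priority schedule. A running task is executed by the processor whose number is
the number of running tasks of higher priority. -/
noncomputable def fixedPrioritySchedule (M : ℕ) (π : Fin N → ℕ) (s : ℝ) (J : JobSeq N) :
    Schedule M N := fun p t =>
  if h : ∃ x : Fin N × ℕ, t ∈ fixedPriorityTimes M π s J x.1 x.2 ∧
      (higherRunning M π s J x.1 t).ncard = p
  then some h.choose else none

lemma fixedPriorityTimes_eq (i : Fin N) (j : ℕ) : fixedPriorityTimes M π s J i j =
    serveTimes (supply M π s J i) s (J.release i) (J.exec i) j := by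
  rw [fixedPriorityTimes]
  simp only [supply, higherRunning, exists_prop]

lemma measurable_ncard_higherRunning
    (h : ∀ k, π k < π i → ∀ j, MeasurableSet (fixedPriorityTimes M π s J k j)) :
    Measurable fun t => (higherRunning M π s J i t).ncard := by
  refine (Measurable.of_discrete (f := Set.ncard)).comp (measurable_set_iff.2 fun k => ?_)
  by_cases hk : π k < π i
  · simp only [higherRunning, Set.mem_ofPred_eq, hk, true_and]
    exact Measurable.exists fun j => (h k hk j).mem
  · simp only [higherRunning, Set.mem_ofPred_eq, hk, false_and, measurable_const]

lemma measurableSet_fixedPriorityTimes (hs : 0 ≤ s) (i : Fin N) (j : ℕ) :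
    MeasurableSet (fixedPriorityTimes M π s J i j) := by
  rw [fixedPriorityTimes_eq]
  exact measurableSet_serveTimes (measurableSet_lt (measurable_ncard_higherRunning
    fun k _ j => measurableSet_fixedPriorityTimes hs k j) measurable_const) hs
termination_by π i

lemma ncard_higherRunning_lt (h : t ∈ fixedPriorityTimes M π s J i j) (hlt : π i < π i') :
    (higherRunning M π s J i t).ncard < (higherRunning M π s J i' t).ncard :=
  Set.ncard_lt_ncard ⟨fun _ hk => ⟨hk.1.trans hlt, hk.2⟩,
    fun hsub => (hsub (show i ∈ _ from ⟨hlt, j, h⟩)).1.false⟩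

lemma eq_of_ncard_higherRunning_eq (hπ : Function.Injective π)
    (h : t ∈ fixedPriorityTimes M π s J i j) (h' : t ∈ fixedPriorityTimes M π s J i' j')
    (hcard : (higherRunning M π s J i t).ncard = (higherRunning M π s J i' t).ncard) : i = i' := by
  by_contra! hne
  rcases (hπ.ne hne).lt_or_gt with hlt | hlt
  · exact (ncard_higherRunning_lt h hlt).ne hcard
  · exact (ncard_higherRunning_lt h' hlt).ne' hcard

lemma fixedPrioritySchedule_eq_some (hπ : Function.Injective π) {p : Fin M} :
    fixedPrioritySchedule M π s J p t = some (i, j) ↔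
      t ∈ fixedPriorityTimes M π s J i j ∧ (higherRunning M π s J i t).ncard = p := by
  unfold fixedPrioritySchedule
  split_ifs with hex
  · rw [Option.some.injEq]
    obtain ⟨hmem, hcard⟩ := hex.choose_spec
    refine ⟨fun heq => by rw [heq] at hmem hcard; exact ⟨hmem, hcard⟩, fun ⟨hmem', hcard'⟩ => ?_⟩
    have hi := eq_of_ncard_higherRunning_eq hπ hmem hmem' (hcard.trans hcard'.symm)
    rw [hi, fixedPriorityTimes_eq] at hmem
    rw [fixedPriorityTimes_eq] at hmem'
    exact Prod.ext hi (serveTimes_unique hmem hmem')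
  · exact iff_of_false nofun fun h => hex ⟨(i, j), h⟩

lemma fixedPrioritySchedule_runs (hπ : Function.Injective π) :
    (fixedPrioritySchedule M π s J).Runs i j t ↔ t ∈ fixedPriorityTimes M π s J i j := by
  simp only [Schedule.Runs, fixedPrioritySchedule_eq_some hπ]
  refine ⟨fun ⟨_, h, _⟩ => h, fun h => ⟨⟨_, ?_⟩, h, rfl⟩⟩
  rw [fixedPriorityTimes_eq] at h
  exact h.1.1

lemma fixedPrioritySchedule_finished (hπ : Function.Injective π) (hs : 0 ≤ s) :
    (fixedPrioritySchedule M π s J).Finished s J i j t ↔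
      t ∈ doneTimes (supply M π s J i) s (J.release i) (J.exec i) j := by
  rw [← le_mul_timeBefore_serveTimes_iff hs, ← fixedPriorityTimes_eq]
  simp only [Schedule.Finished, Schedule.service, fixedPrioritySchedule_runs hπ]
  rfl

lemma fixedPrioritySchedule_runs_iff_ready (hπ : Function.Injective π) (hs : 0 ≤ s) :
    (fixedPrioritySchedule M π s J).Runs i j t ↔
      t ∈ supply M π s J i ∧ (fixedPrioritySchedule M π s J).Ready s J i j t := by
  simp only [fixedPrioritySchedule_runs hπ, fixedPriorityTimes_eq, Schedule.Ready,
    fixedPrioritySchedule_finished hπ hs, serveTimes, slots, Set.mem_sdiff, Set.mem_inter_iff,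
    Set.mem_ofPred_eq]
  tauto

lemma fixedPrioritySchedule_isValid (hπ : Function.Injective π) (hs : 0 ≤ s) :
    (fixedPrioritySchedule M π s J).IsValid s J where
  measurable p i j := by
    simp only [fixedPrioritySchedule_eq_some hπ]
    exact (measurableSet_fixedPriorityTimes hs i j).inter (measurableSet_eq_fun
      (measurable_ncard_higherRunning fun k _ j => measurableSet_fixedPriorityTimes hs k j)
      measurable_const)
  sequential p q t i j j' hp hq := by
    rw [fixedPrioritySchedule_eq_some hπ] at hp hq
    exact Fin.ext (hp.2.symm.trans hq.2)
  arrived i j t h := ((fixedPrioritySchedule_runs_iff_ready hπ hs).1 h).2.1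
  unfinished i j t h := ((fixedPrioritySchedule_runs_iff_ready hπ hs).1 h).2.2.1

lemma exists_higher_of_notMem_supply (hπ : Function.Injective π) (h : t ∉ supply M π s J i)
    (p : Fin M) : ∃ i' j', fixedPrioritySchedule M π s J p t = some (i', j') ∧ π i' < π i := by
  -- The running tasks of higher priority are numbered injectively, hence bijectively, by the
  -- number of running tasks above them.
  let rank i' := (higherRunning M π s J i' t).ncard
  have hmaps : ∀ i' ∈ higherRunning M π s J i t, rank i' ∈ Set.Iio (rank i) :=
    fun i' ⟨hlt, _, hj⟩ => ncard_higherRunning_lt hj hlt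
  obtain ⟨i', ⟨hlt, j', hj'⟩, hrank⟩ := Set.surj_on_of_inj_on_of_ncard_le (fun i' _ => rank i')
    hmaps (fun _ _ ⟨_, _, h₁⟩ ⟨_, _, h₂⟩ => eq_of_ncard_higherRunning_eq hπ h₁ h₂)
    (Set.ncard_Iio_nat _).le (Set.finite_Iio _) p (p.2.trans_le (not_lt.1 h))
  exact ⟨i', j', (fixedPrioritySchedule_eq_some hπ).2 ⟨hj', hrank.symm⟩, hlt⟩

theorem exists_globalFixedPriority {prio : PriorityRule} {τ : TaskSet N} (hs : 0 ≤ s)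
    (hπ : Function.Injective (prio N τ)) (J : JobSeq N) :
    ∃ σ : Schedule M N, globalFixedPriority M prio N τ s J σ := by
  refine ⟨fixedPrioritySchedule M (prio N τ) s J, fixedPrioritySchedule_isValid hπ hs,
    fun i j t h => ((fixedPrioritySchedule_runs_iff_ready hπ hs).1 h).2,
    fun i j t hready hnot => exists_higher_of_notMem_supply hπ fun hsupply => ?_⟩
  exact hnot ((fixedPrioritySchedule_runs_iff_ready hπ hs).2 ⟨hsupply, hready⟩)

end Construction

end GlobalScheduling

theorem theorem5p2_general {M : ℕ} (hM : 0 < M) {prio : GlobalScheduling.PriorityRule}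
    (hDM : prio.IsDeadlineMonotonic) {s : ℝ} (hs : 3 - 1 / (M : ℝ) ≤ s) :
    (GlobalScheduling.globalFixedPriority M prio).HasSpeedupBound s := fun N τ hF J hJ =>
  ⟨GlobalScheduling.exists_globalFixedPriority
      (GlobalScheduling.nonneg_of_three_sub_one_div_le hM hs) (hDM.unique N τ) J,
    fun _ h => ⟨h.1, GlobalScheduling.meetsDeadlines_of_globalFixedPriority hDM hM hs hF hJ h⟩⟩

theorem theorem5p2 (M : ℕ) (hM : 2 ≤ M) (prio : GlobalScheduling.PriorityRule)
    (hDM : prio.IsDeadlineMonotonic) :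
    (GlobalScheduling.globalFixedPriority M prio).HasSpeedupBound (3 - 1 / (M : ℝ)) :=
  theorem5p2_general (by omega) hDM le_rfl
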